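/- **Theorem (Multiple Sphere Upper Bound).** Let $N\ge 1$, $K\ge 1$, $L$ be integers ($L \ge 0$), let $\mathbf M=[\mathbf v_1\cdots\mathbf v_N]\in\mathbb R^{N\times N}$ with $|\det\mathbf M|=1$, let $\Lambda=\mathbf M\mathbb Z^N$ with minimum distance $d_{min}$, and let $\Lambda'=\{\mathbf M\mathbf u:\mathbf u\in\{0,\dots,K-1\}^N\}$ be the finite $K$-PAM lattice constellation. A frame consists of $L$ symbols $\mathbf x_l$, independent and uniform on $\Lambda'$, received as $\mathbf y_l=\mathbf H\mathbf x_l+\mathbf z_l$, where the $\mathbf z_l$ are independent white Gaussian vectors with variance $\sigma^2>0$ per component (SNR $\rho=1/\sigma^2$), independent of $\mathbf H=\mathrm{diag}(h_1,\dots,h_N)$, and $\mathbf H$ is constant over the frame. Each $h_i$ has the Nakagami-$m$ density $\frac{2m^m x^{2m-1}}{\Gamma(m)}e^{-mx^2}$, $x>0$, with $m\ge\frac12$; the joint law of $(h_1,\dots,h_N)$ is otherwise arbitrary. Put $\gamma_i=h_i^2$. For a set $S$ of $k$ basis vectors let $\mathcal V_S(\mathbf H)$ be the Voronoi cell of the origin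 in the sublattice generated by $\{\mathbf H\mathbf v:\mathbf v\in S\}$, taken in the $k$-dimensional subspace it spans, and let $J_S(\mathbf H)=\int_{\mathcal V_S(\mathbf H)}(2\pi\sigma^2)^{-k/2}e^{-\|\mathbf z\|^2/2\sigma^2}\,d\mathbf z$ ($J_\emptyset=1$). Let $\mathcal I_k(\mathbf H)$ be the integral of the same $k$-dimensional Gaussian density over a $k$-dimensional ball centred at $0$ with squared radius $\mathcal R^2(\mathbf H)=\frac{d_{min}^2}{4}\min_i\gamma_i$ ($\mathcal I_0=1$). Define $$P_{msub}(\rho)=1-\mathbb E\left[\left(\frac{\sum_{k=0}^N(K-1)^k\binom Nk\mathcal I_k(\mathbf H)}{K^N}\right)^L\right].$$ (a) If all $h_i>0$, then for every nonempty $S$ the packing radius of the faded sublattice generated by $\{\mathbf H\mathbf v:\mathbf v\in S\}$ is at least $\mathcal R(\mathbf H)=\frac{d_{min}}2\min_i h_i$. (b) The frame error probability of the finite constellation expressed through the faded Voronoi cells, $$P_{f,K\text{-}PAM}(\rho)=1-\mathbb E\left[\left(\frac{\sum_{k=0}^N(K-1)^k\sum_{|S|=k}J_S(\mathbf H)}{K^N}\right)^L\right],$$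 satisfies $P_{f,K\text{-}PAM}(\rho)\le P_{msub}(\rho)$. (c) The frame error probability of maximum likelihood detection with known $\mathbf H$, namely $1-\mathbb E[P_c(\mathbf H)^L]$ with $P_c(\mathbf H)$ the probability, given $\mathbf H$, that a symbol uniform on $\Lambda'$ is correctly detected, is also at most $P_{msub}(\rho)$. -/

import Mathlib

open MeasureTheory

noncomputable section

namespace FadedLattice

/-! Gaussian noise -/

/-- Density at `z` of centred white Gaussian noise of variance `σ ^ 2` per real dimension, on a
finite-dimensional Euclidean space `F`. -/
def gaussDensity {F : Type*} [NormedAddCommGroup F] [InnerProductSpace ℝ F]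
    (σ : ℝ) (z : F) : ℝ :=
  (2 * Real.pi * σ ^ 2) ^ (-(Module.finrank ℝ F : ℝ) / 2) * Real.exp (-(‖z‖ ^ 2) / (2 * σ ^ 2))

/-- Integral of a real function over a region of a finite-dimensional Euclidean space `F`, with
respect to the Lebesgue measure of `F` itself (so, for a `k`-dimensional subspace, the
`k`-dimensional volume). For `k = 0` this measure is the unit point mass. -/
def regionIntegral {F : Type*} [NormedAddCommGroup F] [InnerProductSpace ℝ F]
    [FiniteDimensional ℝ F] [MeasurableSpace F] [BorelSpace F] (A : Set F) (f : F → ℝ) : ℝ :=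
  ∫ z in A, f z ∂(volume : Measure F)

/-- The Gaussian noise mass of a region. -/
def gaussMass {F : Type*} [NormedAddCommGroup F] [InnerProductSpace ℝ F]
    [FiniteDimensional ℝ F] [MeasurableSpace F] [BorelSpace F] (σ : ℝ) (A : Set F) : ℝ :=
  regionIntegral A (gaussDensity σ)

/-! Nakagami fading -/

/-- Density of the Nakagami-`m` distribution with unit mean power. -/
def nakagamiPDF (m x : ℝ) : ℝ :=
  if 0 < x then
    2 * m ^ m * x ^ (2 * m - 1) / Real.Gamma m * Real.exp (-(m * x ^ 2))
  else 0

/-- The Nakagami-`m` distribution on the real line. -/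
def nakagami (m : ℝ) : Measure ℝ :=
  (volume : Measure ℝ).withDensity fun x => ENNReal.ofReal (nakagamiPDF m x)

/-! Lattices and sublattices -/

/-- The faded generator matrix `diag(h) M`. -/
def fadedGenerator {N : ℕ} (h : Fin N → ℝ) (M : Matrix (Fin N) (Fin N) ℝ) :
    Matrix (Fin N) (Fin N) ℝ :=
  Matrix.diagonal h * M

/-- The `j`-th basis vector: the `j`-th column of the generator matrix. -/
def basisVec {N : ℕ} (A : Matrix (Fin N) (Fin N) ℝ) (j : Fin N) : EuclideanSpace ℝ (Fin N) :=
  WithLp.toLp 2 fun i => A i j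

/-- The lattice point `A z`. -/
def latticePoint {N : ℕ} (A : Matrix (Fin N) (Fin N) ℝ) (z : Fin N → ℤ) :
    EuclideanSpace ℝ (Fin N) :=
  WithLp.toLp 2 (A.mulVec fun j => (z j : ℝ))

/-- The sublattice generated by the basis vectors with index in `S`; for `S = Finset.univ` it is
the whole lattice. -/
def sublattice {N : ℕ} (A : Matrix (Fin N) (Fin N) ℝ) (S : Finset (Fin N)) :
    Set (EuclideanSpace ℝ (Fin N)) :=
  {x | ∃ z : Fin N → ℤ, (∀ j, j ∉ S → z j = 0) ∧ x = latticePoint A z}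

/-- The real subspace spanned by the basis vectors with index in `S`. -/
abbrev sublatticeSpan {N : ℕ} (A : Matrix (Fin N) (Fin N) ℝ) (S : Finset (Fin N)) :
    Submodule ℝ (EuclideanSpace ℝ (Fin N)) :=
  Submodule.span ℝ (basisVec A '' (S : Set (Fin N)))

/-- The Voronoi cell of the origin in a sublattice, as a region of the subspace that the
sublattice spans. -/
def voronoiCell {N : ℕ} (A : Matrix (Fin N) (Fin N) ℝ) (S : Finset (Fin N)) :
    Set (sublatticeSpan A S) :=
  {z | ∀ x ∈ sublattice A S,
    ‖(z : EuclideanSpace ℝ (Fin N))‖ ≤ dist (z : EuclideanSpace ℝ (Fin N)) x}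

/-- The minimum distance `d_min` of the lattice generated by `A`. -/
def minDist {N : ℕ} (A : Matrix (Fin N) (Fin N) ℝ) : ℝ :=
  (sublattice A Finset.univ).infsep

/-- The packing radius of a sublattice: half the minimum distance between its points. -/
def packingRadius {N : ℕ} (A : Matrix (Fin N) (Fin N) ℝ) (S : Finset (Fin N)) : ℝ :=
  (sublattice A S).infsep / 2

/-! The frame error probability from the Voronoi cells of the faded sublattices -/

/-- `J_S(H)`: Gaussian mass of the Voronoi cell of the faded sublattice with basis vectors `S`. -/
def voronoiMass {N : ℕ} (M : Matrix (Fin N) (Fin N) ℝ) (σ : ℝ) (S : Finset (Fin N))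
    (h : Fin N → ℝ) : ℝ :=
  gaussMass σ (voronoiCell (fadedGenerator h M) S)

/-- The frame error probability of the `K`-PAM lattice constellation,
`1 - E[((∑ₖ (K-1)^k ∑_{|S|=k} J_S(H)) / K^N)^L]`. -/
def fepKPAM {Ω : Type*} [MeasurableSpace Ω] (P : Measure Ω) {N : ℕ} (H : Ω → Fin N → ℝ)
    (M : Matrix (Fin N) (Fin N) ℝ) (K L : ℕ) (σ : ℝ) : ℝ :=
  1 - ∫ ω, ((∑ k ∈ Finset.range (N + 1), ((K : ℝ) - 1) ^ k *
      ∑ S ∈ Finset.powersetCard k (Finset.univ : Finset (Fin N)), voronoiMass M σ S (H ω))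
        / (K : ℝ) ^ N) ^ L ∂P

/-! The frame error probability of maximum likelihood detection -/

/-- The point `A u` of the finite constellation, with coordinates `u i ∈ {0, …, K - 1}`. -/
def constPoint {N K : ℕ} (A : Matrix (Fin N) (Fin N) ℝ) (u : Fin N → Fin K) :
    EuclideanSpace ℝ (Fin N) :=
  latticePoint A fun j => ((u j : ℕ) : ℤ)

/-- Maximum likelihood decision region of `A u`: the received vectors to which no point of the
finite constellation is closer. -/
def decisionRegion {N K : ℕ} (A : Matrix (Fin N) (Fin N) ℝ) (u : Fin N → Fin K) :
    Set (EuclideanSpace ℝ (Fin N)) :=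
  {y | ∀ w : Fin N → Fin K, dist y (constPoint A u) ≤ dist y (constPoint A w)}

/-- Probability, given the fading `h`, of correct maximum likelihood reception of one symbol drawn
uniformly from the `K ^ N` points of the constellation. -/
def symbolCorrect {N : ℕ} (M : Matrix (Fin N) (Fin N) ℝ) (K : ℕ) (σ : ℝ) (h : Fin N → ℝ) : ℝ :=
  (∑ u : Fin N → Fin K, regionIntegral (decisionRegion (fadedGenerator h M) u)
      fun y => gaussDensity σ (y - constPoint (fadedGenerator h M) u)) / (K : ℝ) ^ N

/-- Frame error probability of maximum likelihood detection: the `L` symbols of a frame see the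
same fading and independent noise, and the frame is correct when all of them are. -/
def fepML {Ω : Type*} [MeasurableSpace Ω] (P : Measure Ω) {N : ℕ} (H : Ω → Fin N → ℝ)
    (M : Matrix (Fin N) (Fin N) ℝ) (K L : ℕ) (σ : ℝ) : ℝ :=
  1 - ∫ ω, symbolCorrect M K σ (H ω) ^ L ∂P

/-! The multiple sphere upper bound -/

/-- The radius `(d_min / 2) * min_i h_i`; for nonnegative `h` its square is
`(d_min ^ 2 / 4) * min_i h_i ^ 2`. -/
def sphereRadius {N : ℕ} (M : Matrix (Fin N) (Fin N) ℝ) (h : Fin N → ℝ) : ℝ :=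
  minDist M / 2 * ⨅ i, h i

/-- The Gaussian mass of the `k`-dimensional ball of radius `(d_min / 2) * min_i h_i`. -/
def sphereMass {N : ℕ} (M : Matrix (Fin N) (Fin N) ℝ) (σ : ℝ) (k : ℕ) (h : Fin N → ℝ) : ℝ :=
  gaussMass σ (Metric.closedBall (0 : EuclideanSpace ℝ (Fin k)) (sphereRadius M h))

/-- The multiple sphere upper bound. -/
def msub {Ω : Type*} [MeasurableSpace Ω] (P : Measure Ω) {N : ℕ} (H : Ω → Fin N → ℝ)
    (M : Matrix (Fin N) (Fin N) ℝ) (K L : ℕ) (σ : ℝ) : ℝ :=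
  1 - ∫ ω, ((∑ k ∈ Finset.range (N + 1), ((K : ℝ) - 1) ^ k * (N.choose k : ℝ) *
      sphereMass M σ k (H ω)) / (K : ℝ) ^ N) ^ L ∂P

end FadedLattice

end

/-! All fading coefficients are almost surely positive, so each claim reduces to a fixed `h > 0`.
Multiplying coordinate `i` by `h i` shrinks no norm by more than `⨅ i, h i`, so distinct faded
lattice points are at least `2r` apart, with `r` the sphere radius. This gives (a), and by
Cauchy–Schwarz the ball of radius `r` in the span of `S` lies in the Voronoi cell, which gives (b).

Claim (c) does not pass through (b). It is proved by counting at each fixed noise vector `z`. Let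
`p_S` be the projection of `z` to the span of `S`. By signs of coordinates of `p_S` and of inner
products with `z - p_S`, each `S` receives a set of `(K-1)^|S|` constellation points `u`, those for
which `p_S` is the nearest point to `z` in the tangent cone at `u`. Uniqueness of nearest points
makes these sets disjoint (`subset_of_mem_faceIndices`). If `‖p_S‖ ≤ r`, every `u` in the set of `S`
is decoded correctly (`add_constPoint_mem_decisionRegion`). Hence the number of correctly decoded
`u` is at least the sum of `(K-1)^|S|` over all `S` with `‖p_S‖ ≤ r`; integrating against the
Gaussian density yields the sphere masses. -/

noncomputable section

namespace FadedLattice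

/-! ### White Gaussian noise and its projections -/

section Gaussian

variable {F : Type*} [NormedAddCommGroup F] [InnerProductSpace ℝ F]

theorem gaussDensity_nonneg (σ : ℝ) (z : F) : 0 ≤ gaussDensity σ z := by
  unfold gaussDensity
  positivity

theorem continuous_gaussDensity (σ : ℝ) : Continuous (gaussDensity σ : F → ℝ) := by
  unfold gaussDensity
  fun_prop

/-- Pythagoras splits the exponent, and additivity of dimension splits the normalising constant. -/
theorem gaussDensity_eq_mul {σ : ℝ} (hσ : 0 < σ) [FiniteDimensional ℝ F] (V : Submodule ℝ F)
    (z : F) :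
    gaussDensity σ z = gaussDensity σ (V.orthogonalProjectionOnto z) *
      gaussDensity σ (Vᗮ.orthogonalProjectionOnto z) := by
  have hn : ‖z‖ ^ 2 = ‖V.orthogonalProjectionOnto z‖ ^ 2 +
      ‖Vᗮ.orthogonalProjectionOnto z‖ ^ 2 :=
    V.norm_sq_eq_add_norm_sq_projection z
  have hd : (Module.finrank ℝ F : ℝ) = Module.finrank ℝ V + Module.finrank ℝ Vᗮ := by
    exact_mod_cast V.finrank_add_finrank_orthogonal.symm
  unfold gaussDensity
  rw [hn, hd, mul_mul_mul_comm, ← Real.exp_add, ← Real.rpow_add (by positivity)]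
  ring_nf

variable [FiniteDimensional ℝ F] [MeasurableSpace F] [BorelSpace F]

theorem integral_gaussDensity {σ : ℝ} (hσ : 0 < σ) : ∫ z : F, gaussDensity σ z = 1 := by
  have hb : 0 < 1 / (2 * σ ^ 2) := by positivity
  have h := GaussianFourier.integral_rexp_neg_mul_sq_norm (V := F) hb
  have h2 : ∀ z : F, Real.exp (-(‖z‖ ^ 2) / (2 * σ ^ 2)) =
      Real.exp (-(1 / (2 * σ ^ 2)) * ‖z‖ ^ 2) := fun z => by ring_nf
  unfold gaussDensity
  simp_rw [h2]
  rw [integral_const_mul, h]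
  have h3 : Real.pi / (1 / (2 * σ ^ 2)) = 2 * Real.pi * σ ^ 2 := by field_simp
  rw [h3, ← Real.rpow_add (by positivity), neg_div, neg_add_cancel, Real.rpow_zero]

theorem integrable_gaussDensity {σ : ℝ} (hσ : 0 < σ) :
    Integrable (gaussDensity σ : F → ℝ) :=
  .of_integral_ne_zero (by rw [integral_gaussDensity hσ]; exact one_ne_zero)

theorem gaussMass_nonneg (σ : ℝ) (A : Set F) : 0 ≤ gaussMass σ A :=
  integral_nonneg fun z => gaussDensity_nonneg σ z

theorem gaussMass_mono {σ : ℝ} (hσ : 0 < σ) {A B : Set F} (h : A ⊆ B) :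
    gaussMass σ A ≤ gaussMass σ B :=
  setIntegral_mono_set (integrable_gaussDensity hσ).integrableOn
    (.of_forall fun z => gaussDensity_nonneg σ z) (.of_forall h)

theorem gaussMass_le_one {σ : ℝ} (hσ : 0 < σ) (A : Set F) : gaussMass σ A ≤ 1 := by
  refine (gaussMass_mono hσ A.subset_univ).trans ?_
  rw [gaussMass, regionIntegral, setIntegral_univ, integral_gaussDensity hσ]

theorem gaussMass_preimage_linearIsometryEquiv {G : Type*} [NormedAddCommGroup G]
    [InnerProductSpace ℝ G] [FiniteDimensional ℝ G] [MeasurableSpace G] [BorelSpace G]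
    (e : F ≃ₗᵢ[ℝ] G) (σ : ℝ) (B : Set G) : gaussMass σ (e ⁻¹' B) = gaussMass σ B := by
  have h := e.measurePreserving.setIntegral_preimage_emb
    e.toHomeomorph.measurableEmbedding (gaussDensity σ) B
  unfold gaussMass regionIntegral
  rw [← h]
  simp [gaussDensity, e.toLinearEquiv.finrank_eq]

/-- The projection of white Gaussian noise to a subspace is white Gaussian noise. -/
theorem gaussMass_preimage_orthogonalProjection {σ : ℝ} (hσ : 0 < σ) (V : Submodule ℝ F)
    {B : Set V} (hB : MeasurableSet B) :
    gaussMass σ {z : F | V.orthogonalProjectionOnto z ∈ B} = gaussMass σ B := by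
  have hm : MeasurableSet {z : F | V.orthogonalProjectionOnto z ∈ B} :=
    V.orthogonalProjectionOnto.continuous.measurable hB
  have hp : MeasurePreserving (fun z : F =>
      (V.orthogonalProjectionOnto z, Vᗮ.orthogonalProjectionOnto z)) volume volume := by
    have h := (WithLp.volume_preserving_ofLp V Vᗮ).comp V.orthogonalDecomposition.measurePreserving
    convert! h using 1
    ext z <;> simp
  unfold gaussMass regionIntegral
  rw [← integral_indicator hm, ← integral_indicator hB]
  -- The integrand is a product over `V × Vᗮ`; the factor on `Vᗮ` integrates to 1.
  have h1 : ∀ z : F, Set.indicator {z : F | V.orthogonalProjectionOnto z ∈ B} (gaussDensity σ) z =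
      (fun p : V × Vᗮ => B.indicator (gaussDensity σ) p.1 * gaussDensity σ p.2)
        (V.orthogonalProjectionOnto z, Vᗮ.orthogonalProjectionOnto z) := by
    intro z
    by_cases hz : V.orthogonalProjectionOnto z ∈ B
    · simp [Set.indicator, hz, ← gaussDensity_eq_mul hσ V z]
    · simp [Set.indicator, hz]
  simp_rw [h1]
  rw [← integral_map (f := fun p : V × Vᗮ => B.indicator (gaussDensity σ) p.1 * gaussDensity σ p.2)
    hp.measurable.aemeasurable, hp.map_eq, Measure.volume_eq_prod, integral_prod_mul,
    integral_gaussDensity hσ, mul_one]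
  have := ((continuous_gaussDensity (F := V) σ).measurable.indicator hB)
  have := (continuous_gaussDensity (F := Vᗮ) σ).measurable
  exact Measurable.aestronglyMeasurable (by fun_prop)

/-- Turns balls of different dimensions into cylinders of one ambient space, where they can be
compared point by point. -/
theorem gaussMass_closedBall_eq {σ : ℝ} (hσ : 0 < σ) (V : Submodule ℝ F) {k : ℕ}
    (hk : Module.finrank ℝ V = k) (r : ℝ) :
    gaussMass σ (Metric.closedBall (0 : EuclideanSpace ℝ (Fin k)) r) =
      gaussMass σ {z : F | ‖V.orthogonalProjectionOnto z‖ ≤ r} := by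
  have h := gaussMass_preimage_orthogonalProjection hσ V
    (Metric.isClosed_closedBall (x := 0) (ε := r)).measurableSet
  simp only [mem_closedBall_zero_iff] at h
  rw [h]
  subst hk
  rw [← gaussMass_preimage_linearIsometryEquiv (stdOrthonormalBasis ℝ V).repr]
  simp

end Gaussian

/-! ### Distances in the faded lattice -/

section Lattice

variable {N : ℕ}

theorem latticePoint_sub (A : Matrix (Fin N) (Fin N) ℝ) (z w : Fin N → ℤ) :
    latticePoint A (z - w) = latticePoint A z - latticePoint A w := by
  unfold latticePoint
  rw [← WithLp.toLp_sub, ← Matrix.mulVec_sub]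
  congr 2
  ext j
  simp

theorem latticePoint_zero (A : Matrix (Fin N) (Fin N) ℝ) : latticePoint A 0 = 0 := by
  simpa using latticePoint_sub A 0 0

theorem latticePoint_eq_sum (A : Matrix (Fin N) (Fin N) ℝ) (z : Fin N → ℤ) :
    latticePoint A z = ∑ j, (z j : ℝ) • basisVec A j := by
  ext i
  simp [latticePoint, basisVec, Matrix.mulVec, dotProduct, mul_comm]

theorem latticePoint_mem_span (A : Matrix (Fin N) (Fin N) ℝ) {S : Finset (Fin N)}
    {z : Fin N → ℤ} (hz : ∀ j, j ∉ S → z j = 0) : latticePoint A z ∈ sublatticeSpan A S := by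
  rw [latticePoint_eq_sum]
  refine Submodule.sum_mem _ fun j _ => ?_
  by_cases hj : j ∈ S
  · exact Submodule.smul_mem _ _ (Submodule.subset_span ⟨j, hj, rfl⟩)
  · simp [hz j hj]

theorem linearIndependent_basisVec {A : Matrix (Fin N) (Fin N) ℝ} (hA : A.det ≠ 0) :
    LinearIndependent ℝ (basisVec A) :=
  (Matrix.linearIndependent_cols_of_det_ne_zero hA).map'
    (WithLp.linearEquiv 2 ℝ (Fin N → ℝ)).symm.toLinearMap (LinearEquiv.ker _)

/-- The basis of columns of an invertible generator matrix. -/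
def columnBasis {A : Matrix (Fin N) (Fin N) ℝ} (hA : A.det ≠ 0) :
    Module.Basis (Fin N) ℝ (EuclideanSpace ℝ (Fin N)) :=
  basisOfLinearIndependentOfCardEqFinrank' (basisVec A) (linearIndependent_basisVec hA) (by simp)

@[simp]
theorem coe_columnBasis {A : Matrix (Fin N) (Fin N) ℝ} (hA : A.det ≠ 0) :
    ⇑(columnBasis hA) = basisVec A := by
  simp [columnBasis]

theorem latticePoint_injective {A : Matrix (Fin N) (Fin N) ℝ} (hA : A.det ≠ 0) :
    Function.Injective (latticePoint A) := by
  intro z w h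
  ext j
  have h1 := congrArg (fun x => (columnBasis hA).repr x j) h
  simp only [latticePoint_eq_sum, ← coe_columnBasis hA, Module.Basis.repr_sum_self] at h1
  exact_mod_cast h1

theorem finrank_sublatticeSpan {A : Matrix (Fin N) (Fin N) ℝ} (hA : A.det ≠ 0)
    (S : Finset (Fin N)) : Module.finrank ℝ (sublatticeSpan A S) = S.card := by
  have h := finrank_span_eq_card
    ((linearIndependent_basisVec hA).comp (Subtype.val : S → Fin N) Subtype.val_injective)
  rw [Set.range_comp, Subtype.range_coe_subtype] at h
  simpa using h

theorem det_fadedGenerator_ne_zero {M : Matrix (Fin N) (Fin N) ℝ} (hM : M.det ≠ 0)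
    {h : Fin N → ℝ} (hh : ∀ i, 0 < h i) : (fadedGenerator h M).det ≠ 0 := by
  simp [fadedGenerator, Matrix.det_mul, hM, Finset.prod_ne_zero_iff, (hh _).ne']

theorem minDist_le_norm {M : Matrix (Fin N) (Fin N) ℝ} (hM : M.det ≠ 0) {w : Fin N → ℤ}
    (hw : w ≠ 0) : minDist M ≤ ‖latticePoint M w‖ := by
  have h := Set.infsep_le_dist_of_mem (s := sublattice M Finset.univ)
    ⟨w, by simp, rfl⟩ ⟨0, by simp, rfl⟩ ((latticePoint_injective hM).ne hw)
  rwa [latticePoint_zero, dist_zero_right] at h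

theorem iInf_mul_norm_le_norm_faded (M : Matrix (Fin N) (Fin N) ℝ) {h : Fin N → ℝ}
    (hh : ∀ i, 0 < h i) (w : Fin N → ℤ) :
    (⨅ i, h i) * ‖latticePoint M w‖ ≤ ‖latticePoint (fadedGenerator h M) w‖ := by
  have h0 : 0 ≤ ⨅ i, h i := Real.iInf_nonneg fun i => (hh i).le
  refine le_of_sq_le_sq ?_ (norm_nonneg _)
  rw [mul_pow, EuclideanSpace.norm_sq_eq, EuclideanSpace.norm_sq_eq, Finset.mul_sum]
  refine Finset.sum_le_sum fun i _ => ?_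
  have h1 : latticePoint (fadedGenerator h M) w i = h i * latticePoint M w i := by
    simp [latticePoint, fadedGenerator, ← Matrix.mulVec_mulVec, Matrix.mulVec_diagonal]
  rw [h1, norm_mul, mul_pow, Real.norm_of_nonneg (hh i).le]
  gcongr
  exact ciInf_le (Set.finite_range h).bddBelow i

/-- Distinct points of the faded lattice are at least two sphere radii apart. -/
theorem two_mul_sphereRadius_le_norm {M : Matrix (Fin N) (Fin N) ℝ} (hM : M.det ≠ 0)
    {h : Fin N → ℝ} (hh : ∀ i, 0 < h i) {w : Fin N → ℤ} (hw : w ≠ 0) :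
    2 * sphereRadius M h ≤ ‖latticePoint (fadedGenerator h M) w‖ := by
  refine le_trans ?_ (iInf_mul_norm_le_norm_faded M hh w)
  have h0 : 0 ≤ ⨅ i, h i := Real.iInf_nonneg fun i => (hh i).le
  have := mul_le_mul_of_nonneg_left (minDist_le_norm hM hw) h0
  rw [sphereRadius]
  linarith

theorem sphereRadius_le_packingRadius {M : Matrix (Fin N) (Fin N) ℝ} (hM : M.det ≠ 0)
    {h : Fin N → ℝ} (hh : ∀ i, 0 < h i) {S : Finset (Fin N)} (hS : S.Nonempty) :
    sphereRadius M h ≤ packingRadius (fadedGenerator h M) S := by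
  have hA := det_fadedGenerator_ne_zero hM hh
  obtain ⟨j, hj⟩ := hS
  -- The `infsep` of a set with at most one point is 0 by convention, so a second point must be
  -- exhibited.
  have hnt : (sublattice (fadedGenerator h M) S).Nontrivial := by
    refine ⟨_, ⟨0, by simp, rfl⟩, _, ⟨Pi.single j 1, ?_, rfl⟩, fun he => ?_⟩
    · intro i hi
      exact Pi.single_eq_of_ne (by rintro rfl; exact hi hj) 1
    · simpa using congrFun (latticePoint_injective hA he) j
  rw [packingRadius, le_div_iff₀ two_pos, mul_comm]
  refine hnt.le_infsep ?_
  rintro _ ⟨z, -, rfl⟩ _ ⟨w, -, rfl⟩ hne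
  rw [dist_eq_norm, ← latticePoint_sub]
  refine two_mul_sphereRadius_le_norm hM hh (sub_ne_zero.2 ?_)
  rintro rfl
  exact hne rfl

end Lattice

/-! ### Balls inside Voronoi cells -/

section Voronoi

variable {N : ℕ}

/-- The points of the ambient space that the projection to the span of a sublattice maps into the
Voronoi cell of the origin. -/
def voronoiCylinder (A : Matrix (Fin N) (Fin N) ℝ) (S : Finset (Fin N)) :
    Set (EuclideanSpace ℝ (Fin N)) :=
  {z | ∀ w : Fin N → ℤ, (∀ j, j ∉ S → w j = 0) →
    2 * inner ℝ z (latticePoint A w) ≤ ‖latticePoint A w‖ ^ 2}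

theorem norm_le_dist_iff {F : Type*} [NormedAddCommGroup F] [InnerProductSpace ℝ F] (z x : F) :
    ‖z‖ ≤ dist z x ↔ 2 * inner ℝ z x ≤ ‖x‖ ^ 2 := by
  rw [dist_eq_norm, ← sq_le_sq₀ (norm_nonneg _) (norm_nonneg _), norm_sub_sq_real]
  constructor <;> intro h <;> linarith

theorem isClosed_voronoiCell (A : Matrix (Fin N) (Fin N) ℝ) (S : Finset (Fin N)) :
    IsClosed (voronoiCell A S) := by
  simp only [voronoiCell, Set.ofPred_forall]
  exact isClosed_biInter fun x _ => isClosed_le (by fun_prop) (by fun_prop)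

theorem inner_orthogonalProjectionOnto_of_mem {F : Type*} [NormedAddCommGroup F]
    [InnerProductSpace ℝ F] (V : Submodule ℝ F) [V.HasOrthogonalProjection] (z : F) {x : F}
    (hx : x ∈ V) : inner ℝ (V.orthogonalProjectionOnto z : F) x = inner ℝ z x :=
  V.inner_orthogonalProjectionOnto_eq_of_mem_right ⟨x, hx⟩ z

/-- The half-space inequalities of the cell involve only inner products with vectors of the span,
which projecting `z` does not change. The subspace depending on `h` thus disappears, which also
serves measurability in `h`. -/
theorem voronoiMass_eq (M : Matrix (Fin N) (Fin N) ℝ) {σ : ℝ} (hσ : 0 < σ) (S : Finset (Fin N))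
    (h : Fin N → ℝ) :
    voronoiMass M σ S h = gaussMass σ (voronoiCylinder (fadedGenerator h M) S) := by
  rw [voronoiMass, ← gaussMass_preimage_orthogonalProjection hσ _
    (isClosed_voronoiCell _ S).measurableSet]
  congr 1
  ext z
  simp only [voronoiCell, voronoiCylinder, Set.mem_ofPred_eq, norm_le_dist_iff, sublattice]
  constructor
  · intro hz w hw
    have := hz _ ⟨w, hw, rfl⟩
    rwa [inner_orthogonalProjectionOnto_of_mem _ _ (latticePoint_mem_span _ hw)] at this
  · rintro hz _ ⟨w, hw, rfl⟩
    rw [inner_orthogonalProjectionOnto_of_mem _ _ (latticePoint_mem_span _ hw)]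
    exact hz w hw

theorem sphereMass_eq {M : Matrix (Fin N) (Fin N) ℝ} (hM : M.det ≠ 0) {σ : ℝ} (hσ : 0 < σ)
    {h : Fin N → ℝ} (hh : ∀ i, 0 < h i) (S : Finset (Fin N)) :
    sphereMass M σ S.card h = gaussMass σ {z : EuclideanSpace ℝ (Fin N) |
      ‖(sublatticeSpan (fadedGenerator h M) S).orthogonalProjectionOnto z‖ ≤ sphereRadius M h} :=
  gaussMass_closedBall_eq hσ _ (finrank_sublatticeSpan (det_fadedGenerator_ne_zero hM hh) S) _

theorem sphereMass_le_voronoiMass {M : Matrix (Fin N) (Fin N) ℝ} (hM : M.det ≠ 0) {σ : ℝ}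
    (hσ : 0 < σ) {h : Fin N → ℝ} (hh : ∀ i, 0 < h i) (S : Finset (Fin N)) :
    sphereMass M σ S.card h ≤ voronoiMass M σ S h := by
  rw [sphereMass_eq hM hσ hh, voronoiMass_eq M hσ]
  refine gaussMass_mono hσ fun z hz w hw => ?_
  rcases eq_or_ne w 0 with rfl | hw0
  · simp [latticePoint_zero]
  rw [← inner_orthogonalProjectionOnto_of_mem _ _ (latticePoint_mem_span _ hw)]
  have h1 := two_mul_sphereRadius_le_norm hM hh hw0
  have h2 := real_inner_le_norm
    ((sublatticeSpan (fadedGenerator h M) S).orthogonalProjectionOnto z : EuclideanSpace ℝ (Fin N))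
    (latticePoint (fadedGenerator h M) w)
  have h3 : ‖((sublatticeSpan (fadedGenerator h M) S).orthogonalProjectionOnto z :
    EuclideanSpace ℝ (Fin N))‖ ≤ sphereRadius M h := hz
  nlinarith [norm_nonneg (latticePoint (fadedGenerator h M) w)]

end Voronoi

/-! ### Counting correctly decoded points for a fixed noise vector -/

section Counting

variable {N : ℕ} {A : Matrix (Fin N) (Fin N) ℝ}

/-- The component of `z` in the span of the basis vectors with index in `S`. -/
def spanPart (A : Matrix (Fin N) (Fin N) ℝ) (S : Finset (Fin N)) (z : EuclideanSpace ℝ (Fin N)) :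
    EuclideanSpace ℝ (Fin N) :=
  (sublatticeSpan A S).orthogonalProjectionOnto z

theorem spanPart_mem (S : Finset (Fin N)) (z : EuclideanSpace ℝ (Fin N)) :
    spanPart A S z ∈ sublatticeSpan A S :=
  ((sublatticeSpan A S).orthogonalProjectionOnto z).2

theorem inner_sub_spanPart_eq_zero {S : Finset (Fin N)} (z : EuclideanSpace ℝ (Fin N))
    {x : EuclideanSpace ℝ (Fin N)} (hx : x ∈ sublatticeSpan A S) :
    inner ℝ (z - spanPart A S z) x = 0 := by
  rw [inner_sub_left, spanPart, inner_orthogonalProjectionOnto_of_mem _ _ hx, sub_self]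

/-- The quantity whose sign matters in direction `i`: the coordinate of the component of `z` in
the span of `S` if `i ∈ S`, the inner product of the orthogonal component with the basis vector
otherwise. -/
def faceCoord (hA : A.det ≠ 0) (S : Finset (Fin N)) (z : EuclideanSpace ℝ (Fin N)) (i : Fin N) :
    ℝ :=
  if i ∈ S then (columnBasis hA).repr (spanPart A S z) i
  else inner ℝ (z - spanPart A S z) (basisVec A i)

/-- The end of `{0, …, n}` in the direction of the sign of `t`. -/
def signedEnd (n : ℕ) (t : ℝ) : Fin (n + 1) := if 0 < t then Fin.last n else 0

/-- The constellation points `u` for which the component of `z` in the span of `S` is the nearest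
point to `z` of the tangent cone at `u` of the convex hull of the constellation, and lies on a
face parallel to that span. -/
def faceIndices (hA : A.det ≠ 0) (n : ℕ) (S : Finset (Fin N)) (z : EuclideanSpace ℝ (Fin N)) :
    Finset (Fin N → Fin (n + 1)) :=
  Fintype.piFinset fun i =>
    if i ∈ S then {signedEnd n (faceCoord hA S z i)}ᶜ else {signedEnd n (faceCoord hA S z i)}

/-- One of `n + 1` values is excluded in each direction of `S`, and the value is forced in the
others; the count does not depend on `z`. -/
theorem card_faceIndices (hA : A.det ≠ 0) (n : ℕ) (S : Finset (Fin N))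
    (z : EuclideanSpace ℝ (Fin N)) : (faceIndices hA n S z).card = n ^ S.card := by
  rw [faceIndices, Fintype.card_piFinset]
  have : ∀ i, (if i ∈ S then {signedEnd n (faceCoord hA S z i)}ᶜ
      else {signedEnd n (faceCoord hA S z i)} : Finset (Fin (n + 1))).card =
      if i ∈ S then n else 1 := by
    intro i
    split_ifs
    · simp [Finset.card_compl]
    · simp
  simp only [this]
  simp

theorem mem_faceIndices {hA : A.det ≠ 0} {n : ℕ} {S : Finset (Fin N)}
    {z : EuclideanSpace ℝ (Fin N)} {u : Fin N → Fin (n + 1)} :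
    u ∈ faceIndices hA n S z ↔
      (∀ i ∈ S, u i ≠ signedEnd n ((columnBasis hA).repr (spanPart A S z) i)) ∧
      ∀ i ∉ S, u i = signedEnd n (inner ℝ (z - spanPart A S z) (basisVec A i)) := by
  simp only [faceIndices, Fintype.mem_piFinset, faceCoord]
  constructor
  · intro h
    exact ⟨fun i hi => by simpa [hi] using h i, fun i hi => by simpa [hi] using h i⟩
  · rintro ⟨h1, h2⟩ i
    by_cases hi : i ∈ S
    · simpa [hi] using h1 i hi
    · simpa [hi] using h2 i hi

theorem repr_eq_zero_of_mem_sublatticeSpan (hA : A.det ≠ 0) {S : Finset (Fin N)}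
    {x : EuclideanSpace ℝ (Fin N)} (hx : x ∈ sublatticeSpan A S) {i : Fin N} (hi : i ∉ S) :
    (columnBasis hA).repr x i = 0 := by
  rw [sublatticeSpan, ← coe_columnBasis hA, Module.Basis.mem_span_image] at hx
  by_contra h
  exact hi (hx (Finsupp.mem_support_iff.2 h))

theorem inner_sub_spanPart_sum_nonpos {S : Finset (Fin N)} {z : EuclideanSpace ℝ (Fin N)}
    {c : Fin N → ℝ}
    (hc : ∀ i ∉ S, c i * inner ℝ (z - spanPart A S z) (basisVec A i) ≤ 0) :
    inner ℝ (z - spanPart A S z) (∑ i, c i • basisVec A i) ≤ 0 := by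
  rw [inner_sum]
  refine Finset.sum_nonpos fun i _ => ?_
  rw [inner_smul_right]
  by_cases hi : i ∈ S
  · rw [inner_sub_spanPart_eq_zero z (Submodule.subset_span ⟨i, hi, rfl⟩), mul_zero]
  · exact hc i hi

/-- Different ends mean that exactly one of `s`, `t` is positive. For `n = 0` the ends coincide and
the hypothesis fails. -/
theorem mul_nonpos_of_signedEnd_ne {n : ℕ} {s t : ℝ} (h : signedEnd n s ≠ signedEnd n t) :
    s * t ≤ 0 := by
  unfold signedEnd at h
  split_ifs at h with hs ht ht
  · exact absurd rfl h
  · exact mul_nonpos_of_nonneg_of_nonpos hs.le (not_lt.1 ht)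
  · exact mul_nonpos_of_nonpos_of_nonneg (not_lt.1 hs) ht.le
  · exact absurd rfl h

/-- The residual for `S` lies in the polar of the tangent cone at `u`, and the projection for `T`
lies in that cone. -/
theorem inner_sub_spanPart_spanPart_nonpos {hA : A.det ≠ 0} {n : ℕ} {S T : Finset (Fin N)}
    {z : EuclideanSpace ℝ (Fin N)} {u : Fin N → Fin (n + 1)} (hS : u ∈ faceIndices hA n S z)
    (hT : u ∈ faceIndices hA n T z) :
    inner ℝ (z - spanPart A S z) (spanPart A T z) ≤ 0 := by
  rw [mem_faceIndices] at hS hT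
  conv_lhs => rw [← (columnBasis hA).sum_repr (spanPart A T z), coe_columnBasis]
  refine inner_sub_spanPart_sum_nonpos fun i hi => ?_
  by_cases hiT : i ∈ T
  · refine mul_nonpos_of_signedEnd_ne (n := n) ?_
    rw [← hS.2 i hi]
    exact (hT.1 i hiT).symm
  · rw [repr_eq_zero_of_mem_sublatticeSpan hA (spanPart_mem T z) hiT, zero_mul]

/-- Uniqueness of the nearest point of a convex cone: the two polarity inequalities and the two
orthogonality relations bound the squared distance of the projections by 0. -/
theorem spanPart_eq_of_mem_faceIndices {hA : A.det ≠ 0} {n : ℕ} {S T : Finset (Fin N)}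
    {z : EuclideanSpace ℝ (Fin N)} {u : Fin N → Fin (n + 1)} (hS : u ∈ faceIndices hA n S z)
    (hT : u ∈ faceIndices hA n T z) : spanPart A S z = spanPart A T z := by
  have h1 := inner_sub_spanPart_spanPart_nonpos hS hT
  have h2 := inner_sub_spanPart_spanPart_nonpos hT hS
  have h3 := inner_sub_spanPart_eq_zero z (spanPart_mem (A := A) S z)
  have h4 := inner_sub_spanPart_eq_zero z (spanPart_mem (A := A) T z)
  have h5 : inner ℝ (spanPart A S z - spanPart A T z) (spanPart A S z - spanPart A T z) ≤ 0 := by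
    simp only [inner_sub_left, inner_sub_right] at h1 h2 h3 h4 ⊢
    linarith
  exact sub_eq_zero.1 (real_inner_self_nonpos.1 h5)

/-- For `i` in `S` but not in `T`, the common projection has `i`-th coordinate 0 and its residual is
orthogonal to the `i`-th basis vector. Then `u i` must both differ from and equal `signedEnd n 0`.
The fixed tie rule at 0 makes this work for every `z`, with no general position assumption. -/
theorem subset_of_mem_faceIndices {hA : A.det ≠ 0} {n : ℕ} {S T : Finset (Fin N)}
    {z : EuclideanSpace ℝ (Fin N)} {u : Fin N → Fin (n + 1)} (hS : u ∈ faceIndices hA n S z)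
    (hT : u ∈ faceIndices hA n T z) : S ⊆ T := by
  have he := spanPart_eq_of_mem_faceIndices hS hT
  rw [mem_faceIndices] at hS hT
  intro i hi
  by_contra hiT
  have h1 := hS.1 i hi
  have h2 := hT.2 i hiT
  rw [he, repr_eq_zero_of_mem_sublatticeSpan hA (spanPart_mem T z) hiT] at h1
  rw [← he, inner_sub_spanPart_eq_zero z (Submodule.subset_span ⟨i, hi, rfl⟩)] at h2
  exact h1 h2

theorem constPoint_eq_sum {K : ℕ} (u : Fin N → Fin K) :
    constPoint A u = ∑ i, ((u i : ℕ) : ℝ) • basisVec A i := by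
  simp [constPoint, latticePoint_eq_sum]

theorem sub_mul_nonpos_of_eq_signedEnd {n : ℕ} {v w : Fin (n + 1)} {t : ℝ}
    (hv : v = signedEnd n t) : (((w : ℕ) : ℝ) - ((v : ℕ) : ℝ)) * t ≤ 0 := by
  unfold signedEnd at hv
  split_ifs at hv with ht
  · refine mul_nonpos_of_nonpos_of_nonneg (sub_nonpos.2 ?_) ht.le
    rw [hv]
    exact_mod_cast Fin.le_last w
  · refine mul_nonpos_of_nonneg_of_nonpos ?_ (not_lt.1 ht)
    simp [hv]

/-- For a difference `d` to another constellation point, the residual contributes at most 0 to the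
inner product of `z` and `d`, and the projection at most `r * ‖d‖ ≤ ‖d‖ ^ 2 / 2`. -/
theorem add_constPoint_mem_decisionRegion {hA : A.det ≠ 0} {n : ℕ} {S : Finset (Fin N)}
    {z : EuclideanSpace ℝ (Fin N)} {u : Fin N → Fin (n + 1)} (hS : u ∈ faceIndices hA n S z)
    {r : ℝ} (hr : ∀ w : Fin N → ℤ, w ≠ 0 → 2 * r ≤ ‖latticePoint A w‖)
    (hz : ‖spanPart A S z‖ ≤ r) : z + constPoint A u ∈ decisionRegion A u := by
  intro w
  rcases eq_or_ne w u with rfl | hwu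
  · exact le_rfl
  rw [mem_faceIndices] at hS
  have h1 : inner ℝ (z - spanPart A S z) (constPoint A w - constPoint A u) ≤ 0 := by
    rw [constPoint_eq_sum, constPoint_eq_sum, ← Finset.sum_sub_distrib]
    simp_rw [← sub_smul]
    exact inner_sub_spanPart_sum_nonpos fun i hi => sub_mul_nonpos_of_eq_signedEnd (hS.2 i hi)
  have h2 : 2 * r ≤ ‖constPoint A w - constPoint A u‖ := by
    rw [constPoint, constPoint, ← latticePoint_sub]
    refine hr _ fun h => hwu ?_
    ext i
    have := congrFun h i
    simp only [Pi.sub_apply, Pi.zero_apply] at this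
    omega
  have h3 := real_inner_le_norm (spanPart A S z) (constPoint A w - constPoint A u)
  have h4 : dist (z + constPoint A u) (constPoint A w) =
      dist z (constPoint A w - constPoint A u) := by
    rw [dist_eq_norm, dist_eq_norm]
    congr 1
    abel
  rw [h4, dist_eq_norm, add_sub_cancel_right, norm_le_dist_iff]
  rw [inner_sub_left] at h1
  nlinarith [norm_nonneg (constPoint A w - constPoint A u)]

open Classical in
theorem sum_card_pow_le_card_decisionRegion (hA : A.det ≠ 0) (n : ℕ) {r : ℝ}
    (hr : ∀ w : Fin N → ℤ, w ≠ 0 → 2 * r ≤ ‖latticePoint A w‖) (z : EuclideanSpace ℝ (Fin N)) :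
    ∑ S with ‖spanPart A S z‖ ≤ r, n ^ S.card ≤
      (Finset.univ.filter fun u : Fin N → Fin (n + 1) =>
        z + constPoint A u ∈ decisionRegion A u).card := by
  simp_rw [← card_faceIndices hA n _ z]
  rw [← Finset.card_biUnion]
  · refine Finset.card_le_card fun u hu => ?_
    obtain ⟨S, hS, huS⟩ := Finset.mem_biUnion.1 hu
    exact Finset.mem_filter.2 ⟨Finset.mem_univ _,
      add_constPoint_mem_decisionRegion huS hr (Finset.mem_filter.1 hS).2⟩
  · intro S _ T _ hST
    refine Finset.disjoint_left.2 fun u hS hT => hST ?_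
    exact (subset_of_mem_faceIndices hS hT).antisymm (subset_of_mem_faceIndices hT hS)

end Counting

/-! ### Integrating the count over the noise -/

section Comparison

variable {N : ℕ}

theorem sum_sphereMass_eq (M : Matrix (Fin N) (Fin N) ℝ) (σ : ℝ) (K : ℕ) (h : Fin N → ℝ) :
    ∑ k ∈ Finset.range (N + 1), ((K : ℝ) - 1) ^ k * (N.choose k : ℝ) * sphereMass M σ k h =
      ∑ S : Finset (Fin N), ((K : ℝ) - 1) ^ S.card * sphereMass M σ S.card h := by
  have := Finset.sum_powerset_apply_card (fun k => ((K : ℝ) - 1) ^ k * sphereMass M σ k h)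
    (x := (Finset.univ : Finset (Fin N)))
  rw [Finset.powerset_univ, Finset.card_univ, Fintype.card_fin] at this
  rw [this]
  refine Finset.sum_congr rfl fun k _ => ?_
  rw [nsmul_eq_mul]
  ring

theorem sum_voronoiMass_eq (M : Matrix (Fin N) (Fin N) ℝ) (σ : ℝ) (K : ℕ) (h : Fin N → ℝ) :
    ∑ k ∈ Finset.range (N + 1), ((K : ℝ) - 1) ^ k *
      ∑ S ∈ Finset.powersetCard k (Finset.univ : Finset (Fin N)), voronoiMass M σ S h =
      ∑ S : Finset (Fin N), ((K : ℝ) - 1) ^ S.card * voronoiMass M σ S h := by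
  have := Finset.sum_powerset (Finset.univ : Finset (Fin N))
    (fun S => ((K : ℝ) - 1) ^ S.card * voronoiMass M σ S h)
  rw [Finset.powerset_univ, Finset.card_univ, Fintype.card_fin] at this
  rw [this]
  refine Finset.sum_congr rfl fun k _ => ?_
  rw [Finset.mul_sum]
  refine Finset.sum_congr rfl fun S hS => ?_
  rw [(Finset.mem_powersetCard.1 hS).2]

theorem symbolCorrect_eq (M : Matrix (Fin N) (Fin N) ℝ) (K : ℕ) (σ : ℝ) (h : Fin N → ℝ) :
    symbolCorrect M K σ h = (∑ u : Fin N → Fin K, gaussMass σ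
      {z | z + constPoint (fadedGenerator h M) u ∈ decisionRegion (fadedGenerator h M) u})
        / (K : ℝ) ^ N := by
  unfold symbolCorrect
  congr 1
  refine Finset.sum_congr rfl fun u _ => ?_
  have := (measurePreserving_add_right (volume : Measure (EuclideanSpace ℝ (Fin N)))
    (constPoint (fadedGenerator h M) u)).setIntegral_preimage_emb
      (measurableEmbedding_addRight _)
      (fun y => gaussDensity σ (y - constPoint (fadedGenerator h M) u))
      (decisionRegion (fadedGenerator h M) u)
  rw [regionIntegral, ← this]
  simp only [add_sub_cancel_right]
  rfl

theorem isClosed_decisionRegion {K : ℕ} (A : Matrix (Fin N) (Fin N) ℝ) (u : Fin N → Fin K) :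
    IsClosed (decisionRegion A u) := by
  simp only [decisionRegion, Set.ofPred_forall]
  exact isClosed_iInter fun w => isClosed_le (by fun_prop) (by fun_prop)

theorem continuous_spanPart (A : Matrix (Fin N) (Fin N) ℝ) (S : Finset (Fin N)) :
    Continuous (spanPart A S) :=
  continuous_subtype_val.comp (sublatticeSpan A S).orthogonalProjectionOnto.continuous

open Classical in
/-- The sphere masses bound the probabilities of correct detection from below, on average over
the constellation. -/
theorem sum_gaussMass_le_sum_gaussMass {A : Matrix (Fin N) (Fin N) ℝ} (hA : A.det ≠ 0) {σ : ℝ}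
    (hσ : 0 < σ) (n : ℕ) {r : ℝ} (hr : ∀ w : Fin N → ℤ, w ≠ 0 → 2 * r ≤ ‖latticePoint A w‖) :
    ∑ S : Finset (Fin N), (n : ℝ) ^ S.card * gaussMass σ {z | ‖spanPart A S z‖ ≤ r} ≤
      ∑ u : Fin N → Fin (n + 1),
        gaussMass σ {z | z + constPoint A u ∈ decisionRegion A u} := by
  have hB : ∀ S : Finset (Fin N), MeasurableSet {z | ‖spanPart A S z‖ ≤ r} := fun S =>
    (isClosed_le (continuous_spanPart A S).norm continuous_const).measurableSet
  have hD : ∀ u : Fin N → Fin (n + 1),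
      MeasurableSet {z | z + constPoint A u ∈ decisionRegion A u} := fun u =>
    ((isClosed_decisionRegion A u).preimage (continuous_add_const _)).measurableSet
  have hint := integrable_gaussDensity (F := EuclideanSpace ℝ (Fin N)) hσ
  -- With both sides written as integrals of indicators, the claim becomes the pointwise count times
  -- the density.
  unfold gaussMass regionIntegral
  simp_rw [← integral_indicator (hB _), ← integral_indicator (hD _), ← integral_const_mul]
  rw [← integral_finsetSum _ fun S _ => (hint.indicator (hB S)).const_mul _,
    ← integral_finsetSum _ fun u _ => hint.indicator (hD u)]
  refine integral_mono (integrable_finsetSum _ fun S _ => (hint.indicator (hB S)).const_mul _)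
    (integrable_finsetSum _ fun u _ => hint.indicator (hD u)) fun z => ?_
  have h := sum_card_pow_le_card_decisionRegion hA n hr z
  have h' : ((∑ S with ‖spanPart A S z‖ ≤ r, n ^ S.card : ℕ) : ℝ) ≤
      ((Finset.univ.filter fun u : Fin N → Fin (n + 1) =>
        z + constPoint A u ∈ decisionRegion A u).card : ℝ) := by exact_mod_cast h
  have h2 := mul_le_mul_of_nonneg_right h' (gaussDensity_nonneg σ z)
  rw [Finset.card_filter, Finset.sum_filter] at h2
  push_cast at h2
  rw [Finset.sum_mul, Finset.sum_mul] at h2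
  simpa [Set.indicator] using h2

theorem sum_sphereMass_div_le_symbolCorrect {M : Matrix (Fin N) (Fin N) ℝ} (hM : M.det ≠ 0)
    {σ : ℝ} (hσ : 0 < σ) {K : ℕ} (hK : 1 ≤ K) {h : Fin N → ℝ} (hh : ∀ i, 0 < h i) :
    (∑ S : Finset (Fin N), ((K : ℝ) - 1) ^ S.card * sphereMass M σ S.card h) / (K : ℝ) ^ N ≤
      symbolCorrect M K σ h := by
  -- Writing `K = n + 1` makes the weight `K - 1` a natural number, as the count requires.
  obtain ⟨n, rfl⟩ := Nat.exists_eq_add_of_le' hK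
  rw [symbolCorrect_eq]
  refine div_le_div_of_nonneg_right ?_ (by positivity)
  simp_rw [sphereMass_eq hM hσ hh]
  push_cast
  rw [add_sub_cancel_right]
  exact sum_gaussMass_le_sum_gaussMass (det_fadedGenerator_ne_zero hM hh) hσ n
    fun w hw => two_mul_sphereRadius_le_norm hM hh hw

theorem sum_sphereMass_le_sum_voronoiMass {M : Matrix (Fin N) (Fin N) ℝ} (hM : M.det ≠ 0)
    {σ : ℝ} (hσ : 0 < σ) {K : ℕ} (hK : 1 ≤ K) {h : Fin N → ℝ} (hh : ∀ i, 0 < h i) :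
    ∑ S : Finset (Fin N), ((K : ℝ) - 1) ^ S.card * sphereMass M σ S.card h ≤
      ∑ S : Finset (Fin N), ((K : ℝ) - 1) ^ S.card * voronoiMass M σ S h := by
  have hK' : (0 : ℝ) ≤ (K : ℝ) - 1 := sub_nonneg.2 (by exact_mod_cast hK)
  exact Finset.sum_le_sum fun S _ =>
    mul_le_mul_of_nonneg_left (sphereMass_le_voronoiMass hM hσ hh S) (pow_nonneg hK' _)

end Comparison

/-! ### Measurability and boundedness in the fading -/

section Measurability

variable {N : ℕ}

/-- Measurability of a partial integral. It is applied to regions closed jointly in the fading and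
the noise. -/
theorem measurable_gaussMass_section {X F : Type*} [MeasurableSpace X] [NormedAddCommGroup F]
    [InnerProductSpace ℝ F] [FiniteDimensional ℝ F] [MeasurableSpace F] [BorelSpace F] (σ : ℝ)
    {T : Set (X × F)} (hT : MeasurableSet T) :
    Measurable fun x => gaussMass σ {z | (x, z) ∈ T} := by
  have h : ∀ x, gaussMass σ {z | (x, z) ∈ T} =
      ∫ z, T.indicator (fun p => gaussDensity σ p.2) (x, z) := by
    intro x
    exact (integral_indicator (measurable_prodMk_left hT)).symm
  simp_rw [h]
  have hm : Measurable (T.indicator fun p : X × F => gaussDensity σ p.2) :=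
    ((continuous_gaussDensity σ).measurable.comp measurable_snd).indicator hT
  exact hm.stronglyMeasurable.integral_prod_right'.measurable

theorem continuous_latticePoint_fadedGenerator (M : Matrix (Fin N) (Fin N) ℝ) (w : Fin N → ℤ) :
    Continuous fun h : Fin N → ℝ => latticePoint (fadedGenerator h M) w := by
  unfold latticePoint fadedGenerator
  refine (PiLp.continuous_toLp 2 _).comp ?_
  simp_rw [← Matrix.mulVec_mulVec]
  refine continuous_pi fun i => ?_
  simp_rw [Matrix.mulVec_diagonal]
  fun_prop

theorem measurable_voronoiMass (M : Matrix (Fin N) (Fin N) ℝ) {σ : ℝ} (hσ : 0 < σ)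
    (S : Finset (Fin N)) : Measurable (voronoiMass M σ S) := by
  have h : voronoiMass M σ S = fun h => gaussMass σ (voronoiCylinder (fadedGenerator h M) S) :=
    funext fun h => voronoiMass_eq M hσ S h
  rw [h]
  refine measurable_gaussMass_section σ
    (T := {p | p.2 ∈ voronoiCylinder (fadedGenerator p.1 M) S}) (IsClosed.measurableSet ?_)
  change IsClosed {p : (Fin N → ℝ) × EuclideanSpace ℝ (Fin N) |
    ∀ w : Fin N → ℤ, (∀ j, j ∉ S → w j = 0) →
      2 * inner ℝ p.2 (latticePoint (fadedGenerator p.1 M) w) ≤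
        ‖latticePoint (fadedGenerator p.1 M) w‖ ^ 2}
  simp only [Set.ofPred_forall]
  refine isClosed_iInter fun w => isClosed_iInter fun _ => ?_
  have hw := (continuous_latticePoint_fadedGenerator M w).comp
    (continuous_fst (X := Fin N → ℝ) (Y := EuclideanSpace ℝ (Fin N)))
  exact isClosed_le (continuous_const.mul (continuous_snd.inner hw)) (hw.norm.pow 2)

theorem measurable_symbolCorrect (M : Matrix (Fin N) (Fin N) ℝ) (K : ℕ) (σ : ℝ) :
    Measurable (symbolCorrect M K σ) := by
  simp_rw [funext (symbolCorrect_eq M K σ)]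
  refine Measurable.div_const (Finset.measurable_fun_sum _ fun u _ => ?_) _
  refine measurable_gaussMass_section σ
    (T := {p | p.2 + constPoint (fadedGenerator p.1 M) u ∈
      decisionRegion (fadedGenerator p.1 M) u}) (IsClosed.measurableSet ?_)
  change IsClosed {p : (Fin N → ℝ) × EuclideanSpace ℝ (Fin N) | ∀ w : Fin N → Fin K,
    dist (p.2 + constPoint (fadedGenerator p.1 M) u) (constPoint (fadedGenerator p.1 M) u) ≤
      dist (p.2 + constPoint (fadedGenerator p.1 M) u) (constPoint (fadedGenerator p.1 M) w)}
  simp only [constPoint, Set.ofPred_forall]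
  refine isClosed_iInter fun w => ?_
  have h1 := (continuous_latticePoint_fadedGenerator M fun j => ((u j : ℕ) : ℤ)).comp
    (continuous_fst (X := Fin N → ℝ) (Y := EuclideanSpace ℝ (Fin N)))
  have h2 := (continuous_latticePoint_fadedGenerator M fun j => ((w j : ℕ) : ℤ)).comp
    (continuous_fst (X := Fin N → ℝ) (Y := EuclideanSpace ℝ (Fin N)))
  exact isClosed_le ((continuous_snd.add h1).dist h1) ((continuous_snd.add h1).dist h2)

theorem integrable_comp_pow_of_bound {Ω X : Type*} [MeasurableSpace Ω] [MeasurableSpace X]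
    {P : Measure Ω} [IsFiniteMeasure P] {H : Ω → X} (hH : AEMeasurable H P) {g : X → ℝ}
    (hg : Measurable g) {C : ℝ} (hC : ∀ x, |g x| ≤ C) (L : ℕ) :
    Integrable (fun ω => g (H ω) ^ L) P := by
  refine Integrable.of_bound (C := C ^ L)
    ((hg.pow_const L).comp_aemeasurable hH).aestronglyMeasurable (.of_forall fun ω => ?_)
  rw [norm_pow]
  exact pow_le_pow_left₀ (norm_nonneg _) (hC _) L

/-- Serves integrability only: any bound uniform in `h`, including `h` with nonpositive entries,
would do. -/
theorem abs_sum_voronoiMass_le (M : Matrix (Fin N) (Fin N) ℝ) {σ : ℝ} (hσ : 0 < σ) {K : ℕ}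
    (hK : 1 ≤ K) (h : Fin N → ℝ) :
    |(∑ S : Finset (Fin N), ((K : ℝ) - 1) ^ S.card * voronoiMass M σ S h) / (K : ℝ) ^ N| ≤
      (∑ S : Finset (Fin N), ((K : ℝ) - 1) ^ S.card) / (K : ℝ) ^ N := by
  have hK' : (0 : ℝ) ≤ (K : ℝ) - 1 := sub_nonneg.2 (by exact_mod_cast hK)
  have h0 : 0 ≤ (∑ S : Finset (Fin N), ((K : ℝ) - 1) ^ S.card * voronoiMass M σ S h) /
      (K : ℝ) ^ N :=
    div_nonneg (Finset.sum_nonneg fun S _ =>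
      mul_nonneg (pow_nonneg hK' _) (gaussMass_nonneg _ _)) (by positivity)
  rw [abs_of_nonneg h0]
  refine div_le_div_of_nonneg_right (Finset.sum_le_sum fun S _ => ?_) (by positivity)
  exact mul_le_of_le_one_right (pow_nonneg hK' _) (gaussMass_le_one hσ _)

theorem abs_symbolCorrect_le (M : Matrix (Fin N) (Fin N) ℝ) {σ : ℝ} (hσ : 0 < σ) (K : ℕ)
    (h : Fin N → ℝ) :
    |symbolCorrect M K σ h| ≤ (∑ _u : Fin N → Fin K, (1 : ℝ)) / (K : ℝ) ^ N := by
  rw [symbolCorrect_eq, abs_of_nonneg (div_nonneg (Finset.sum_nonneg fun u _ =>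
    gaussMass_nonneg _ _) (by positivity))]
  exact div_le_div_of_nonneg_right (Finset.sum_le_sum fun u _ => gaussMass_le_one hσ _)
    (by positivity)

end Measurability

/-! ### Almost sure positivity of the fading, and the theorem -/

theorem ae_pos_of_hasLaw_nakagami {Ω : Type*} [MeasurableSpace Ω] {P : Measure Ω} {m : ℝ}
    {X : Ω → ℝ} (hX : ProbabilityTheory.HasLaw X (nakagami m) P) : ∀ᵐ ω ∂P, 0 < X ω := by
  refine ae_of_ae_map (p := fun x => 0 < x) hX.aemeasurable ?_
  rw [hX.map_eq, ae_iff, nakagami]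
  have hs : {x : ℝ | ¬ 0 < x} = Set.Iic 0 := by ext; simp
  rw [hs, withDensity_apply _ measurableSet_Iic]
  refine (setLIntegral_congr_fun measurableSet_Iic fun x hx => ?_).trans lintegral_zero
  simp [nakagamiPDF, not_lt.2 (Set.mem_Iic.1 hx)]

end FadedLattice

end

theorem theorem3 {Ω : Type*} [MeasurableSpace Ω] (P : MeasureTheory.Measure Ω)
    [MeasureTheory.IsProbabilityMeasure P]
    (N K L : ℕ) (hN : 1 ≤ N) (hK : 1 ≤ K)
    (M : Matrix (Fin N) (Fin N) ℝ) (hM : |M.det| = 1)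
    (σ : ℝ) (hσ : 0 < σ)
    (m : ℝ) (hm : 1 / 2 ≤ m)
    (H : Ω → Fin N → ℝ)
    (hH : ∀ i, ProbabilityTheory.HasLaw (fun ω => H ω i) (FadedLattice.nakagami m) P) :
    (∀ h : Fin N → ℝ, (∀ i, 0 < h i) → ∀ S : Finset (Fin N), S.Nonempty →
      FadedLattice.sphereRadius M h ≤
        FadedLattice.packingRadius (FadedLattice.fadedGenerator h M) S) ∧
    FadedLattice.fepKPAM P H M K L σ ≤ FadedLattice.msub P H M K L σ ∧
    FadedLattice.fepML P H M K L σ ≤ FadedLattice.msub P H M K L σ := by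
  have hM0 : M.det ≠ 0 := by
    intro h
    simp [h] at hM
  have hHm : AEMeasurable H P := aemeasurable_pi_iff.2 fun i => (hH i).aemeasurable
  have hpos : ∀ᵐ ω ∂P, ∀ i, 0 < H ω i :=
    ae_all_iff.2 fun i => FadedLattice.ae_pos_of_hasLaw_nakagami (hH i)
  have hK' : (0 : ℝ) ≤ (K : ℝ) - 1 := sub_nonneg.2 (by exact_mod_cast hK)
  have hnn : ∀ h, 0 ≤ (∑ S : Finset (Fin N), ((K : ℝ) - 1) ^ S.card *
      FadedLattice.sphereMass M σ S.card h) / (K : ℝ) ^ N := fun h =>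
    div_nonneg (Finset.sum_nonneg fun S _ => mul_nonneg (pow_nonneg hK' _)
      (FadedLattice.gaussMass_nonneg _ _)) (by positivity)
  refine ⟨fun h hh S hS => FadedLattice.sphereRadius_le_packingRadius hM0 hh hS, ?_, ?_⟩
  · unfold FadedLattice.fepKPAM FadedLattice.msub
    simp_rw [FadedLattice.sum_sphereMass_eq, FadedLattice.sum_voronoiMass_eq]
    -- Only the larger integrand has to be integrable; the sphere side needs nonnegativity but no
    -- measurability.
    refine sub_le_sub_left (integral_mono_of_nonneg (.of_forall fun ω => pow_nonneg (hnn _) _)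
      (FadedLattice.integrable_comp_pow_of_bound hHm (g := fun h =>
        (∑ S : Finset (Fin N), ((K : ℝ) - 1) ^ S.card * FadedLattice.voronoiMass M σ S h) /
          (K : ℝ) ^ N) ?_ (FadedLattice.abs_sum_voronoiMass_le M hσ hK) L) ?_) _
    · exact Measurable.div_const (Finset.measurable_fun_sum _ fun S _ =>
        (FadedLattice.measurable_voronoiMass M hσ S).const_mul _) _
    · filter_upwards [hpos] with ω hω
      exact pow_le_pow_left₀ (hnn _) (div_le_div_of_nonneg_right
        (FadedLattice.sum_sphereMass_le_sum_voronoiMass hM0 hσ hK hω) (by positivity)) L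
  · unfold FadedLattice.fepML FadedLattice.msub
    simp_rw [FadedLattice.sum_sphereMass_eq]
    refine sub_le_sub_left (integral_mono_of_nonneg (.of_forall fun ω => pow_nonneg (hnn _) _)
      (FadedLattice.integrable_comp_pow_of_bound hHm
        (FadedLattice.measurable_symbolCorrect M K σ)
        (FadedLattice.abs_symbolCorrect_le M hσ K) L) ?_) _
    filter_upwards [hpos] with ω hω
    exact pow_le_pow_left₀ (hnn _)
      (FadedLattice.sum_sphereMass_div_le_symbolCorrect hM0 hσ hK hω) L
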